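/- Let $k$ be an integral domain. A $k$-functor is a functor from commutative $k$-algebras to sets. For a $k$-algebra $R$ let $\mathrm{GL}_{\mathbb N}(R)$ be the group of invertible elements of the monoid of column-finite $\mathbb N\times\mathbb N$ matrices over $R$, and let $B(R)\subseteq \mathrm{GL}_{\mathbb N}(R)$ be the subset of upper triangular matrices ($x_{ij}=0$ for $i>j$). A permutation $\sigma\in\mathrm{Perm}(\mathbb N)$ is identified with its permutation matrix, whose $j$-th column is the standard basis vector $e_{\sigma(j)}$, and $B\sigma B\subseteq \mathrm{GL}_{\mathbb N}$ denotes the subfunctor $R\mapsto \{b\sigma c : b,c\in B(R)\}$. A subfunctor $\mathcal Y$ of a $k$-functor $\mathcal X$ is called closed if for every $k$-algebra $R$ and every morphism $f:\mathrm{Hom}_k(R,-)\to\mathcal X$ there is an ideal $\mathfrak r\subseteq R$ such that, for all $k$-algebras $A$, $f^{-1}(\mathcal Y)(A)=\{\varphi:R\to A \mid \varphi(\mathfrak r)=0\}$. The closure $\overline{\mathcal Y}$ of a subfunctor $\mathcal Y\subseteq\mathcal X$ is the intersection of all closed subfunctors of $\mathcal X$ that contain $\mathcal Y$. The infinite Bruhat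 order on $\mathrm{Perm}(\mathbb N)$ is defined as follows: $\tau\le\sigma$ if and only if for every $n$, when $\tau(1),\dots,\tau(n)$ and $\sigma(1),\dots,\sigma(n)$ are each rearranged in increasing order as $x_1<\dots<x_n$ and $y_1<\dots<y_n$ respectively, one has $x_i\le y_i$ for all $1\le i\le n$. **Theorem.** Let $k$ be an integral domain and $\sigma\in\mathrm{Perm}(\mathbb N)$. Then $\overline{B\sigma B}\subseteq \mathrm{GL}_{\mathbb N}$ is covered by the disjoint subfunctors $B\tau B$ for $\tau\le\sigma$. That is: 1. for every $\tau\le\sigma$, $B\tau B$ is a subfunctor of $\overline{B\sigma B}$, i.e. $(B\tau B)(R)\subseteq\overline{B\sigma B}(R)$ for every $k$-algebra $R$; 2. if $\tau,\tau'\le\sigma$ and $\tau\ne\tau'$, then $(B\tau B)(R)\cap (B\tau' B)(R)=\emptyset$ for every nonzero $k$-algebra $R$; 3. for every $k$-algebra $R$ that is a field, $\overline{B\sigma B}(R)=\bigcup_{\tau\le\sigma}(B\tau B)(R)$. -/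

import Mathlib

open CategoryTheory

universe u

namespace InfSchubert

/-! ### Column-finite matrices and the general linear functor

Rows and columns are indexed by `ℕ`, whose least element is written `0`. -/

/-- Column-finite `ℕ × ℕ` matrices: every column has finite support. -/
@[ext]
structure ColFin (R : Type u) [CommRing R] where
  /-- The entries. -/
  val : Matrix ℕ ℕ R
  finite_col : ∀ j, {i | val i j ≠ 0}.Finite

namespace ColFin

variable {R S T : Type u} [CommRing R] [CommRing S] [CommRing T]

/-- The matrix product; the sum over `n` has finite support because `y` is column finite. -/
noncomputable def mulVal (x y : Matrix ℕ ℕ R) : Matrix ℕ ℕ R :=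
  Matrix.of fun i j => ∑ᶠ n, x i n * y n j

theorem mulVal_eq_sum (x y : Matrix ℕ ℕ R) (i j : ℕ) (s : Finset ℕ)
    (hs : ∀ n, y n j ≠ 0 → n ∈ s) : mulVal x y i j = ∑ n ∈ s, x i n * y n j := by
  refine finsum_eq_sum_of_support_subset _ ?_
  intro n hn
  exact hs n (fun h => hn (by simp [h]))

theorem mul_finite (x y : ColFin R) (j : ℕ) : {i | mulVal x.val y.val i j ≠ 0}.Finite := by
  refine ((y.finite_col j).biUnion (fun n _ => x.finite_col n)).subset ?_
  intro i hi
  have hi' : ∑ᶠ n, x.val i n * y.val n j ≠ 0 := hi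
  obtain ⟨n, hn⟩ : ∃ n, x.val i n * y.val n j ≠ 0 := by
    by_contra! h
    exact hi' (by simp [h])
  simp only [Set.mem_iUnion, Set.mem_ofPred_eq, exists_prop]
  exact ⟨n, right_ne_zero_of_mul hn, left_ne_zero_of_mul hn⟩

noncomputable instance : Mul (ColFin R) := ⟨fun x y => ⟨mulVal x.val y.val, mul_finite x y⟩⟩

/-- The identity matrix. -/
instance : One (ColFin R) :=
  ⟨⟨1, fun j => (Set.finite_singleton j).subset (fun i hi => by
    by_contra h
    exact hi (Matrix.one_apply_ne h))⟩⟩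

theorem mul_val (x y : ColFin R) (i j : ℕ) : (x * y).val i j = ∑ᶠ n, x.val i n * y.val n j := rfl

theorem one_val : (1 : ColFin R).val = 1 := rfl

theorem mul_val_eq_sum (x y : ColFin R) (i j : ℕ) (s : Finset ℕ)
    (hs : ∀ n, y.val n j ≠ 0 → n ∈ s) :
    (x * y).val i j = ∑ n ∈ s, x.val i n * y.val n j :=
  mulVal_eq_sum _ _ _ _ _ hs

noncomputable instance : Monoid (ColFin R) where
  mul_assoc x y z := by
    ext i j
    set s : Finset ℕ := (z.finite_col j).toFinset with hs
    set t : Finset ℕ := s.biUnion (fun m => (y.finite_col m).toFinset) with ht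
    have hzs : ∀ n, z.val n j ≠ 0 → n ∈ s := fun n hn => by simpa [hs] using hn
    have hyt : ∀ m ∈ s, ∀ n, y.val n m ≠ 0 → n ∈ t := fun m hm n hn => by
      rw [ht, Finset.mem_biUnion]
      exact ⟨m, hm, by simpa using hn⟩
    have hyz : ∀ n, (y * z).val n j ≠ 0 → n ∈ t := fun n hn => by
      rw [mul_val_eq_sum y z n j s hzs] at hn
      obtain ⟨m, hm, hmn⟩ := Finset.exists_ne_zero_of_sum_ne_zero hn
      exact hyt m hm n (left_ne_zero_of_mul hmn)
    rw [mul_val_eq_sum (x * y) z i j s hzs, mul_val_eq_sum x (y * z) i j t hyz]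
    have h1 : ∀ m ∈ s, (x * y).val i m * z.val m j
        = ∑ n ∈ t, x.val i n * y.val n m * z.val m j := fun m hm => by
      rw [mul_val_eq_sum x y i m t (hyt m hm), Finset.sum_mul]
    have h2 : ∀ n ∈ t, x.val i n * (y * z).val n j
        = ∑ m ∈ s, x.val i n * y.val n m * z.val m j := fun n _ => by
      rw [mul_val_eq_sum y z n j s hzs, Finset.mul_sum]
      simp only [mul_assoc]
    rw [Finset.sum_congr rfl h1, Finset.sum_congr rfl h2, Finset.sum_comm]
  one_mul x := by
    ext i j
    rw [mul_val, finsum_eq_single _ i]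
    · simp [one_val]
    · intro n hn
      simp [one_val, Matrix.one_apply_ne hn.symm]
  mul_one x := by
    ext i j
    rw [mul_val, finsum_eq_single _ j]
    · simp [one_val]
    · intro n hn
      simp [one_val, Matrix.one_apply_ne hn]

/-- Entrywise application of a ring homomorphism. -/
def map (φ : R →+* S) : ColFin R →* ColFin S where
  toFun x := ⟨x.val.map φ, fun j => (x.finite_col j).subset (fun i hi h => hi (by
    simp only [Matrix.map_apply, h, map_zero]))⟩
  map_one' := by
    ext i j
    simp [one_val, Matrix.one_apply, apply_ite φ]
  map_mul' x y := by
    ext i j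
    have hs : ∀ n, y.val n j ≠ 0 → n ∈ (y.finite_col j).toFinset := fun n hn => by simpa using hn
    rw [mul_val_eq_sum _ _ i j (y.finite_col j).toFinset]
    · change φ ((x * y).val i j) = ∑ n ∈ _, φ (x.val i n) * φ (y.val n j)
      rw [mul_val_eq_sum x y i j _ hs, map_sum]
      simp only [map_mul]
    · intro n hn
      refine hs n (fun h => hn ?_)
      simp only [Matrix.map_apply, h, map_zero]

theorem map_val (φ : R →+* S) (x : ColFin R) (i j : ℕ) : (map φ x).val i j = φ (x.val i j) := rfl

/-- The matrix of a permutation: column `j` is the standard basis vector with index `σ j`. -/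
def perm (R : Type u) [CommRing R] (σ : Equiv.Perm ℕ) : ColFin R where
  val := Matrix.of fun i j => if i = σ j then 1 else 0
  finite_col j := (Set.finite_singleton (σ j)).subset (fun i hi => by
    by_contra h
    exact hi (if_neg h))

theorem perm_val (σ : Equiv.Perm ℕ) (i j : ℕ) :
    (perm R σ).val i j = if i = σ j then 1 else 0 := rfl

theorem perm_mul (σ τ : Equiv.Perm ℕ) : perm R σ * perm R τ = perm R (σ * τ) := by
  ext i j
  rw [mul_val, finsum_eq_single _ (τ j)]
  · simp only [perm_val, if_true, mul_one, Equiv.Perm.mul_apply]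
    rfl
  · intro n hn
    simp [perm_val, hn]

theorem perm_one : perm R 1 = 1 := by
  ext i j
  simp only [perm_val, one_val, Matrix.one_apply, Equiv.Perm.one_apply]
  rfl

theorem map_perm (φ : R →+* S) (σ : Equiv.Perm ℕ) : map φ (perm R σ) = perm S σ := by
  ext i j
  simp [map_val, perm_val, apply_ite φ]

end ColFin

/-- The group of invertible column-finite matrices. -/
abbrev GLInf (R : Type u) [CommRing R] : Type u := (ColFin R)ˣ

/-- The permutation matrix of `σ` as an element of `GLInf R`. -/
def permGL (R : Type u) [CommRing R] (σ : Equiv.Perm ℕ) : GLInf R where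
  val := ColFin.perm R σ
  inv := ColFin.perm R σ⁻¹
  val_inv := by rw [ColFin.perm_mul, mul_inv_cancel, ColFin.perm_one]
  inv_val := by rw [ColFin.perm_mul, inv_mul_cancel, ColFin.perm_one]

variable (k : Type u) [CommRing k]

/-- The `k`-functor `R ↦ GLInf R`. A `k`-functor is a functor from commutative `k`-algebras
to types. -/
noncomputable def glFunctor : CommAlgCat.{u} k ⥤ Type u where
  obj R := GLInf R
  map φ := ↾(Units.map (ColFin.map (φ.hom : _ →+* _)))
  map_id R := by
    ext g
    rfl
  map_comp φ ψ := by
    ext g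
    rfl

/-- The subfunctor `B` of upper triangular matrices. -/
def borel : Subfunctor (glFunctor k) where
  obj R := {g : GLInf R | ∀ i j : ℕ, j < i → g.val.val i j = 0}
  map {R S} φ := by
    intro g hg i j hij
    change φ.hom ((show GLInf R from g).val.val i j) = 0
    rw [hg i j hij, map_zero]

/-- The subfunctor `R ↦ B(R) σ B(R)`. -/
def doubleCoset (σ : Equiv.Perm ℕ) : Subfunctor (glFunctor k) where
  obj R := {g : GLInf R | ∃ b c : GLInf R, b ∈ (borel k).obj R ∧ c ∈ (borel k).obj R ∧
    g = b * permGL R σ * c}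
  map {R S} φ := by
    rintro g ⟨b, c, hb, hc, rfl⟩
    refine ⟨_, _, (borel k).map φ hb, (borel k).map φ hc, ?_⟩
    change Units.map (ColFin.map (φ.hom : R →+* S)) (b * permGL R σ * c) =
      Units.map (ColFin.map (φ.hom : R →+* S)) b * permGL S σ *
        Units.map (ColFin.map (φ.hom : R →+* S)) c
    rw [map_mul, map_mul]
    congr 2
    exact Units.ext (ColFin.map_perm _ σ)

/-! ### Closed subfunctors and closures -/

variable {k}

/-- The subfunctor `V(I)` of `h^R = Hom(R, -)`: the homomorphisms that kill the ideal `I`. -/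
def vanishing (R : CommAlgCat.{u} k) (I : Ideal R) :
    Subfunctor (coyoneda.obj (Opposite.op R)) where
  obj A := {φ : R ⟶ A | ∀ a ∈ I, φ.hom a = 0}
  map {A A'} ψ := by
    intro φ hφ a ha
    change ψ.hom ((show R ⟶ A from φ).hom a) = 0
    rw [hφ a ha, map_zero]

/-- A subfunctor is closed if its inverse image under every morphism `h^R ⟶ X` is `V(I)` for some
ideal `I` of `R`. -/
def IsClosedSubfunctor {X : CommAlgCat.{u} k ⥤ Type u} (Z : Subfunctor X) : Prop :=
  ∀ (R : CommAlgCat.{u} k) (f : coyoneda.obj (Opposite.op R) ⟶ X),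
    ∃ I : Ideal R, Z.preimage f = vanishing R I

/-- The closure of a subfunctor: the intersection of all closed subfunctors containing it. -/
def closureSubfunctor {X : CommAlgCat.{u} k ⥤ Type u} (Y : Subfunctor X) : Subfunctor X :=
  sInf {Z | IsClosedSubfunctor Z ∧ Y ≤ Z}

/-! ### The infinite Bruhat order -/

/-- Comparison of two `n`-element sets of natural numbers: the elements, listed in increasing
order, are compared one by one. -/
def SubsetLE {n : ℕ} (X Y : Finset ℕ) (hX : X.card = n) (hY : Y.card = n) : Prop :=
  ∀ i : Fin n, X.orderEmbOfFin hX i ≤ Y.orderEmbOfFin hY i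

/-- The set of the first `n` values of a permutation. -/
def firstValues (σ : Equiv.Perm ℕ) (n : ℕ) : Finset ℕ := (Finset.range n).map σ.toEmbedding

theorem card_firstValues (σ : Equiv.Perm ℕ) (n : ℕ) : (firstValues σ n).card = n := by
  simp [firstValues]

/-- The infinite Bruhat order: `τ ≤ σ` if for every `n` the set of the first `n` values of `τ` is
at most the set of the first `n` values of `σ`. -/
def BruhatLE (τ σ : Equiv.Perm ℕ) : Prop :=
  ∀ n : ℕ, SubsetLE (firstValues τ n) (firstValues σ n) (card_firstValues τ n)
    (card_firstValues σ n)

end InfSchubert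

namespace InfSchubert

/-! ### Upper triangular matrices -/

section Upper

variable {R : Type u} [CommRing R]

/-! To place `BτB` in the closure for `τ ≤ σ`, fix a closed `Z` containing `BσB` and degenerate `σ`
to `τ` inside `Z`. Two kinds of specialisation suffice. A transposition: if `p < q` and `τ p < τ q`,
the curve `bτ(1 + X E_qp)c` lies in the double coset of `τ (p q)` where `X` is invertible and passes
through `bτc` at `X = 0`. Equations valid over the Laurent polynomials hold over the polynomials,
hence at `0` (`doubleCoset_le_of_swap`). A limit: if permutations `π n` converge pointwise to `τ`,
then `bτc` is the limit of the points `b (π n) c`, all of them values of one point over the ring of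
eventually constant sequences (`doubleCoset_le_of_tendsto`). By `BruhatLE.exists_swap`, at the first
place where `σ` differs from `τ` the value of `σ` can be lowered by a transposition while staying
above `τ`. Finitely many such moves correct that place; correcting ever longer prefixes gives a
sequence converging to `τ`. For the reverse inclusion, the minors on the first `n` columns and on
rows not below `firstValues σ n` vanish on `BσB`, and their vanishing is a closed condition. Over a
field every `g` lies in some `BτB` (`exists_bruhat_decomposition`), where the minor on `firstValues
τ n` is a unit; so `τ ≤ σ`. Disjointness compares diagonal entries, which are units in an invertible
upper triangular matrix (`perm_eq_of_mul_eq`). -/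

/-- Upper triangular column-finite matrices. -/
def IsUpper (x : ColFin R) : Prop := ∀ i j : ℕ, j < i → x.val i j = 0

theorem IsUpper.mul_val {x : ColFin R} (y : ColFin R) (hx : IsUpper x) (i j : ℕ) :
    (y * x).val i j = ∑ n ∈ Finset.range (j + 1), y.val i n * x.val n j := by
  refine ColFin.mul_val_eq_sum _ _ _ _ _ fun n hn => ?_
  by_contra h
  exact hn (hx n j (by simpa using h))

theorem IsUpper.mul {x y : ColFin R} (hx : IsUpper x) (hy : IsUpper y) : IsUpper (x * y) := by
  intro i j hij
  rw [hy.mul_val]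
  refine Finset.sum_eq_zero fun n hn => ?_
  rw [hx i n (by simp at hn; omega), zero_mul]

theorem IsUpper.mul_val_diag {x y : ColFin R} (hx : IsUpper x) (hy : IsUpper y) (j : ℕ) :
    (x * y).val j j = x.val j j * y.val j j := by
  rw [hy.mul_val, Finset.sum_range_succ, Finset.sum_eq_zero, zero_add]
  intro n hn
  rw [hx j n (by simpa using hn), zero_mul]

/-- Induction on columns: if the columns of `g⁻¹` before `j` vanish below the diagonal, then in rows
`i ≥ j` only one term of the `(i, j)` entry of `g⁻¹ g = 1` survives. -/
theorem IsUpper.inv_col {g : GLInf R} (hg : IsUpper g.val) (j : ℕ) :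
    (g⁻¹.val.val j j * g.val.val j j = 1) ∧ ∀ i, j < i → g⁻¹.val.val i j = 0 := by
  induction j using Nat.strong_induction_on with
  | _ j ih =>
    have key : ∀ i, j ≤ i → g⁻¹.val.val i j * g.val.val j j = (1 : ColFin R).val i j := by
      intro i hi
      rw [← g.inv_val, ← Units.inv_eq_val_inv, hg.mul_val, Finset.sum_range_succ,
        Finset.sum_eq_zero, zero_add]
      intro n hn
      have hn' : n < j := by simpa using hn
      rw [Units.inv_eq_val_inv, (ih n hn').2 i (by omega), zero_mul]
    have hd : g⁻¹.val.val j j * g.val.val j j = 1 := by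
      rw [key j le_rfl, ColFin.one_val, Matrix.one_apply_eq]
    refine ⟨hd, fun i hi => ?_⟩
    have h := key i hi.le
    rw [ColFin.one_val, Matrix.one_apply_ne hi.ne'] at h
    calc g⁻¹.val.val i j = g⁻¹.val.val i j * g.val.val j j * g⁻¹.val.val j j := by
          rw [mul_assoc, mul_comm (g.val.val j j), hd, mul_one]
      _ = 0 := by rw [h, zero_mul]

theorem IsUpper.inv {g : GLInf R} (hg : IsUpper g.val) : IsUpper g⁻¹.val :=
  fun i j hij => (hg.inv_col j).2 i hij

theorem IsUpper.isUnit_diag {g : GLInf R} (hg : IsUpper g.val) (j : ℕ) :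
    IsUnit (g.val.val j j) :=
  IsUnit.of_mul_eq_one_right _ (hg.inv_col j).1

theorem ColFin.mul_perm_val (x : ColFin R) (σ : Equiv.Perm ℕ) (i j : ℕ) :
    (x * ColFin.perm R σ).val i j = x.val i (σ j) := by
  rw [ColFin.mul_val, finsum_eq_single _ (σ j)]
  · simp [ColFin.perm_val]
  · intro n hn
    simp [ColFin.perm_val, hn]

theorem ColFin.perm_mul_val (x : ColFin R) (σ : Equiv.Perm ℕ) (i j : ℕ) :
    (ColFin.perm R σ * x).val (σ i) j = x.val i j := by
  rw [ColFin.mul_val, finsum_eq_single _ i]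
  · simp [ColFin.perm_val]
  · intro n hn
    simp [ColFin.perm_val, hn.symm]

/-- A permutation of `ℕ` that does not increase any number is the identity. -/
theorem perm_eq_one_of_le (π : Equiv.Perm ℕ) (h : ∀ j, π j ≤ j) : π = 1 := by
  ext j
  induction j using Nat.strong_induction_on with
  | _ j ih =>
    refine (h j).eq_of_not_lt fun hlt => ?_
    have := ih _ hlt
    exact hlt.ne (π.injective (by simpa using this))

/-- The double cosets of distinct permutations are disjoint. -/
theorem perm_eq_of_mul_eq [Nontrivial R] {σ τ : Equiv.Perm ℕ} {b c b' c' : GLInf R}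
    (hb : IsUpper b.val) (hc : IsUpper c.val) (hb' : IsUpper b'.val) (hc' : IsUpper c'.val)
    (h : b * permGL R σ * c = b' * permGL R τ * c') : σ = τ := by
  have hx : IsUpper (c * c'⁻¹).val := hc.mul hc'.inv
  have hy : IsUpper (b⁻¹ * b').val := hb.inv.mul hb'
  have e : permGL R σ * (c * c'⁻¹) = b⁻¹ * b' * permGL R τ := by
    have h' : permGL R σ * c = b⁻¹ * b' * permGL R τ * c' := by
      rw [mul_assoc b⁻¹, mul_assoc b⁻¹, ← h]
      group
    rw [← mul_assoc, h']
    group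
  have ev : ∀ i j, (c * c'⁻¹).val.val i j = (b⁻¹ * b').val.val (σ i) (τ j) := by
    intro i j
    rw [← ColFin.perm_mul_val _ σ, ← ColFin.mul_perm_val]
    exact congrArg (fun g : GLInf R => g.val.val (σ i) j) e
  have h1 : σ⁻¹ * τ = 1 := perm_eq_one_of_le _ fun j => by
    by_contra! hlt
    -- An entry below the diagonal of `c c'⁻¹` would equal a diagonal entry of `b⁻¹ b'`, that is,
    -- zero would be a unit.
    have hj := ev ((σ⁻¹ * τ) j) j
    rw [hx _ _ hlt, ← Equiv.Perm.mul_apply, mul_inv_cancel_left] at hj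
    exact (hy.isUnit_diag (τ j)).ne_zero hj.symm
  exact inv_mul_eq_one.mp h1

/-- An upper triangular matrix with ones on the diagonal. -/
def IsUnitriangular (x : ColFin R) : Prop := IsUpper x ∧ ∀ j, x.val j j = 1

/-- Back substitution: the last coordinate of the solution is forced to be `v m`, and subtracting
that multiple of column `m` shortens the right-hand side. -/
theorem IsUnitriangular.exists_solution {x : ColFin R} (hx : IsUnitriangular x) (m : ℕ) :
    ∀ v : ℕ → R, (∀ n, m ≤ n → v n = 0) →
      ∃ w : ℕ → R, (∀ n, m ≤ n → w n = 0) ∧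
        ∀ i, ∑ n ∈ Finset.range m, x.val i n * w n = v i := by
  induction m with
  | zero => exact fun v hv => ⟨0, fun _ _ => rfl, fun i => by simp [hv i]⟩
  | succ m ih =>
    intro v hv
    obtain ⟨w, hw, hxw⟩ := ih (fun n => v n - x.val n m * v m) fun n hn => by
      rcases hn.eq_or_lt with rfl | hlt
      · simp [hx.2]
      · simp [hv n hlt, hx.1 n m hlt]
    refine ⟨Function.update w m (v m), fun n hn => ?_, fun i => ?_⟩
    · rw [Function.update_of_ne (by omega), hw n (by omega)]
    · rw [Finset.sum_range_succ, Function.update_self, Finset.sum_congr rfl (fun n hn => ?_),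
        hxw i, sub_add_cancel]
      rw [Function.update_of_ne (by simp at hn; omega)]

theorem IsUnitriangular.exists_mul_eq_one {x : ColFin R} (hx : IsUnitriangular x) :
    ∃ y : ColFin R, IsUnitriangular y ∧ x * y = 1 := by
  choose w hw hxw using fun j : ℕ => hx.exists_solution (j + 1) ((1 : Matrix ℕ ℕ R) · j)
    fun n hn => Matrix.one_apply_ne (by omega)
  let y : ColFin R := ⟨Matrix.of fun i j => w j i, fun j =>
    (Set.finite_lt_nat (j + 1)).subset fun i hi => by
      by_contra h
      exact hi (hw j i (by simpa using h))⟩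
  have hy : IsUpper y := fun i j hij => hw j i hij
  have hxy : x * y = 1 := by
    ext i j
    rw [hy.mul_val]
    exact hxw j i
  refine ⟨y, ⟨hy, fun j => ?_⟩, hxy⟩
  have h := hx.1.mul_val_diag hy j
  rw [hxy, hx.2, one_mul, ColFin.one_val, Matrix.one_apply_eq] at h
  exact h.symm

/-- The right inverse is again unitriangular, so it has a right inverse too, which must be `x`. -/
theorem IsUnitriangular.isUnit {x : ColFin R} (hx : IsUnitriangular x) : IsUnit x := by
  obtain ⟨y, hy, hxy⟩ := hx.exists_mul_eq_one
  obtain ⟨z, -, hyz⟩ := hy.exists_mul_eq_one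
  have hz : x = z := left_inv_eq_right_inv hxy hyz
  exact ⟨⟨x, y, hxy, by rw [hz, hyz]⟩, rfl⟩

end Upper

end InfSchubert

namespace InfSchubert

/-! ### Transvections and the curves joining two double cosets -/

section Transvection

variable {R S : Type u} [CommRing R] [CommRing S]

/-- The matrix `1 + s E_{pq}`. -/
def transvection (p q : ℕ) (s : R) : ColFin R where
  val i j := (if i = j then 1 else 0) + if i = p ∧ j = q then s else 0
  finite_col j := (Set.toFinite {j, p}).subset fun i hi => by
    by_contra h
    simp only [Set.mem_insert_iff, Set.mem_singleton_iff, not_or] at h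
    exact hi (by simp [h.1, h.2])

theorem mul_transvection_val (x : ColFin R) (p q : ℕ) (s : R) (i j : ℕ) :
    (x * transvection p q s).val i j = x.val i j + if j = q then x.val i p * s else 0 := by
  rw [ColFin.mul_val_eq_sum _ _ _ _ {j, p}]
  · by_cases hj : j = p
    · subst hj
      by_cases hq : j = q <;> simp [transvection, hq, mul_add]
    · by_cases hq : j = q
      · subst hq
        simp [transvection, Finset.sum_pair hj, Ne.symm hj, hj]
      · simp [transvection, Finset.sum_pair hj, Ne.symm hj, hq]
  · intro n hn
    by_contra h
    simp only [Finset.mem_insert, Finset.mem_singleton, not_or] at h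
    exact hn (by simp [transvection, h.1, h.2])

theorem transvection_mul {p q : ℕ} (hpq : p ≠ q) (s t : R) :
    transvection p q s * transvection p q t = transvection p q (s + t) := by
  ext i j
  rw [mul_transvection_val]
  by_cases hj : j = q <;> by_cases hi : i = p <;> simp [transvection, hi, hj, hpq]

theorem transvection_zero (p q : ℕ) : transvection p q (0 : R) = 1 := by
  ext i j
  simp [transvection, ColFin.one_val, Matrix.one_apply]

theorem map_transvection (φ : R →+* S) (p q : ℕ) (s : R) :
    ColFin.map φ (transvection p q s) = transvection p q (φ s) := by
  ext i j
  simp [ColFin.map_val, transvection, apply_ite φ]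

/-- The matrix `1 + s E_{pq}`, for `p ≠ q`, as an invertible matrix. -/
def transvectionGL {p q : ℕ} (hpq : p ≠ q) (s : R) : GLInf R where
  val := transvection p q s
  inv := transvection p q (-s)
  val_inv := by rw [transvection_mul hpq, add_neg_cancel, transvection_zero]
  inv_val := by rw [transvection_mul hpq, neg_add_cancel, transvection_zero]

theorem isUpper_transvection {p q : ℕ} (hpq : p < q) (s : R) : IsUpper (transvection p q s) := by
  intro i j hij
  have : ¬ (i = p ∧ j = q) := by omega
  simp [transvection, this, hij.ne']

/-- Left multiplication by a lower triangular transvection with invertible parameter turns `τ`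
into an element of the double coset of `τ (p q)`. -/
theorem isUpper_perm_mul_transvection {τ : Equiv.Perm ℕ} {p q : ℕ} (hpq : p < q)
    (hτ : τ p < τ q) {s t : R} (hst : s * t = 1) :
    IsUpper (permGL R τ * transvectionGL hpq.ne' t * transvectionGL hpq.ne (-s) *
      (permGL R (τ * Equiv.swap p q))⁻¹).val := by
  intro a b hba
  change (ColFin.perm R τ * transvection q p t * transvection p q (-s) *
    ColFin.perm R (τ * Equiv.swap p q)⁻¹).val a b = 0
  -- Column `τ (p q) c` of the product is column `c` of `τ(1 + tE_qp)(1 - sE_pq)`. Column `p` is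
  -- `e_{τ p} + t e_{τ q}`; column `q` reduces to `-s e_{τ p}` because `st = 1`.
  obtain ⟨c, rfl⟩ := (τ * Equiv.swap p q).surjective b
  rw [ColFin.mul_perm_val, ← Equiv.Perm.mul_apply _⁻¹, inv_mul_cancel, Equiv.Perm.one_apply, mul_transvection_val, mul_transvection_val,
    mul_transvection_val]
  simp only [ColFin.perm_val]
  rw [Equiv.Perm.mul_apply] at hba
  by_cases h1 : c = p
  · subst h1
    rw [Equiv.swap_apply_left] at hba
    simp [hpq.ne, hba.ne', (hτ.trans hba).ne']
  · by_cases h2 : c = q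
    · subst h2
      rw [Equiv.swap_apply_right] at hba
      by_cases h3 : a = τ c
      · have h4 : t * s = 1 := by rw [mul_comm, hst]
        simp [h3, h1, hτ.ne', h4]
      · simp [h3, h1, hba.ne']
    · rw [Equiv.swap_apply_of_ne_of_ne h1 h2] at hba
      simp [h1, h2, hba.ne']

end Transvection

/-! ### Closed subfunctors and specialisation along curves -/

section Closed

variable {k : Type u} [CommRing k] {R S : Type u} [CommRing R] [CommRing S]

/-- The homomorphism of general linear groups induced by a ring homomorphism. -/
noncomputable def glMap (φ : R →+* S) : GLInf R →* GLInf S := Units.map (ColFin.map φ)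

theorem glMap_val (φ : R →+* S) (g : GLInf R) (i j : ℕ) :
    (glMap φ g).val.val i j = φ (g.val.val i j) := rfl

theorem glMap_permGL (φ : R →+* S) (σ : Equiv.Perm ℕ) : glMap φ (permGL R σ) = permGL S σ :=
  Units.ext (ColFin.map_perm φ σ)

theorem glMap_transvectionGL (φ : R →+* S) {p q : ℕ} (hpq : p ≠ q) (s : R) :
    glMap φ (transvectionGL hpq s) = transvectionGL hpq (φ s) :=
  Units.ext (map_transvection φ p q s)

theorem transvectionGL_zero {p q : ℕ} (hpq : p ≠ q) : transvectionGL hpq (0 : R) = 1 :=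
  Units.ext (transvection_zero p q)

theorem IsUpper.glMap {g : GLInf R} (hg : IsUpper g.val) (φ : R →+* S) :
    IsUpper (glMap φ g).val := fun i j hij => by
  rw [glMap_val, hg i j hij, map_zero]

theorem glMap_glMap_of_comp_eq_id {φ : R →+* S} {ψ : S →+* R} (h : ∀ a, ψ (φ a) = a)
    (g : GLInf R) : InfSchubert.glMap ψ (InfSchubert.glMap φ g) = g := by
  exact Units.ext (ColFin.ext (Matrix.ext fun i j => h _))

/-- Closedness in terms of points, by the Yoneda lemma. -/
theorem IsClosedSubfunctor.exists_ideal {X : CommAlgCat.{u} k ⥤ Type u} {Z : Subfunctor X}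
    (hZ : IsClosedSubfunctor Z) (R : CommAlgCat.{u} k) (x : X.obj R) :
    ∃ I : Ideal R, ∀ (A : CommAlgCat.{u} k) (φ : R ⟶ A),
      X.map φ x ∈ Z.obj A ↔ ∀ a ∈ I, φ.hom a = 0 := by
  obtain ⟨I, hI⟩ := hZ R (coyonedaEquiv.symm x)
  refine ⟨I, fun A φ => ?_⟩
  have h := congrArg (fun W : Subfunctor (coyoneda.obj (Opposite.op R)) => φ ∈ W.obj A) hI
  exact iff_of_eq h

theorem mem_closure_iff {X : CommAlgCat.{u} k ⥤ Type u} {Y : Subfunctor X}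
    {R : CommAlgCat.{u} k} {x : X.obj R} :
    x ∈ (closureSubfunctor Y).obj R ↔ ∀ Z, IsClosedSubfunctor Z → Y ≤ Z → x ∈ Z.obj R := by
  simp only [closureSubfunctor, Subfunctor.sInf_obj, Set.sInf_eq_sInter, Set.mem_sInter,
    Set.mem_image, forall_exists_index, and_imp]
  exact ⟨fun h Z h1 h2 => h _ Z ⟨h1, h2⟩ rfl, fun h _ Z hZ e => e ▸ h Z hZ.1 hZ.2⟩

/-- If `p < q` and `τ p < τ q`, a closed subfunctor that contains the double coset of `τ (p q)`
contains that of `τ`. -/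
theorem doubleCoset_le_of_swap {Z : Subfunctor (glFunctor k)} (hZ : IsClosedSubfunctor Z)
    {τ : Equiv.Perm ℕ} {p q : ℕ} (hpq : p < q) (hτ : τ p < τ q)
    (h : doubleCoset k (τ * Equiv.swap p q) ≤ Z) : doubleCoset k τ ≤ Z := by
  rintro R g ⟨b, c, hb, hc, rfl⟩
  let P : CommAlgCat.{u} k := CommAlgCat.of k (Polynomial R)
  let L : CommAlgCat.{u} k := CommAlgCat.of k (LaurentPolynomial R)
  let j : P ⟶ L := CommAlgCat.ofHom ((Polynomial.toLaurentAlg (R := R)).restrictScalars k)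
  let ev : P ⟶ R := CommAlgCat.ofHom ((Polynomial.aeval (R := R) (0 : R)).restrictScalars k)
  let x : GLInf P := glMap Polynomial.C b * permGL P τ *
    transvectionGL hpq.ne' (Polynomial.X : Polynomial R) * glMap Polynomial.C c
  obtain ⟨I, hI⟩ := hZ.exists_ideal P x
  have hev : (glFunctor k).map ev x = b * permGL R τ * c := by
    change glMap (ev.hom : Polynomial R →+* R) _ = _
    rw [map_mul, map_mul, map_mul, glMap_permGL, glMap_transvectionGL,
      glMap_glMap_of_comp_eq_id, glMap_glMap_of_comp_eq_id]
    · have : (ev.hom : Polynomial R →+* R) Polynomial.X = 0 := Polynomial.aeval_X _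
      rw [this, transvectionGL_zero, mul_one]
    · exact fun a => Polynomial.aeval_C _ a
    · exact fun a => Polynomial.aeval_C _ a
  have hj : (glFunctor k).map j x ∈ Z.obj L := by
    apply h
    let s : LaurentPolynomial R := LaurentPolynomial.T (-1)
    let t : LaurentPolynomial R := LaurentPolynomial.T 1
    have hst : s * t = 1 := by
      rw [← LaurentPolynomial.T_add]
      simp
    let b' : GLInf L := glMap (j.hom : P →+* L) (glMap Polynomial.C b)
    let c' : GLInf L := glMap (j.hom : P →+* L) (glMap Polynomial.C c)
    -- The transvection with parameter `-s` and the matrix of `τ (p q)` are inserted together with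
    -- their inverses, so the product telescopes to the image of `x`.
    refine ⟨b' * (permGL L τ * transvectionGL hpq.ne' t * transvectionGL hpq.ne (-s) *
      (permGL L (τ * Equiv.swap p q))⁻¹), (transvectionGL hpq.ne (-s))⁻¹ * c', ?_, ?_, ?_⟩
    · exact (IsUpper.glMap (IsUpper.glMap hb _) _).mul
        (isUpper_perm_mul_transvection hpq hτ hst)
    · exact (IsUpper.inv (isUpper_transvection hpq _)).mul (IsUpper.glMap (IsUpper.glMap hc _) _)
    · change glMap (j.hom : P →+* L) x = _
      rw [map_mul, map_mul, map_mul, glMap_permGL, glMap_transvectionGL]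
      have : (j.hom : P →+* L) (Polynomial.X : Polynomial R) = t := Polynomial.toLaurent_X
      rw [this]
      change b' * _ * _ * c' = _
      group
  rw [← hev, hI]
  intro a ha
  have h0 : a = 0 := by
    have := (hI L j).mp hj a ha
    exact Polynomial.toLaurent_injective (this.trans (map_zero _).symm)
  rw [h0, map_zero]

/-! ### Pointwise limits of permutations -/

variable (k) in
/-- Sequences in `R` that are eventually constant, together with their limits. -/
def eventuallyConst (R : Type u) [CommRing R] [Algebra k R] : Subalgebra k ((ℕ → R) × R) where
  carrier := {f | ∀ᶠ n in Filter.atTop, f.1 n = f.2}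
  mul_mem' := by
    rintro f g hf hg
    filter_upwards [hf, hg] with n h1 h2
    simp [h1, h2]
  add_mem' := by
    rintro f g hf hg
    filter_upwards [hf, hg] with n h1 h2
    simp [h1, h2]
  algebraMap_mem' r := Filter.Eventually.of_forall fun n => rfl

/-- A sequence of permutations that is eventually constant at every number. -/
def PermTendsto (π : ℕ → Equiv.Perm ℕ) (τ : Equiv.Perm ℕ) : Prop :=
  ∀ j, ∀ᶠ n in Filter.atTop, π n j = τ j

theorem PermTendsto.inv {π : ℕ → Equiv.Perm ℕ} {τ : Equiv.Perm ℕ} (h : PermTendsto π τ) :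
    PermTendsto (fun n => (π n)⁻¹) τ⁻¹ := fun j => by
  filter_upwards [h (τ⁻¹ j)] with n hn
  rw [Equiv.Perm.inv_eq_iff_eq, hn, ← Equiv.Perm.mul_apply, mul_inv_cancel, Equiv.Perm.one_apply]

/-- Needed for `permSeq` to be column finite. -/
theorem PermTendsto.finite_range {π : ℕ → Equiv.Perm ℕ} {τ : Equiv.Perm ℕ}
    (h : PermTendsto π τ) (j : ℕ) : (Set.range fun n => π n j).Finite := by
  obtain ⟨N, hN⟩ := Filter.eventually_atTop.mp (h j)
  refine (((Set.finite_lt_nat N).image fun n => π n j).union (Set.finite_singleton (τ j))).subset ?_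
  rintro _ ⟨n, rfl⟩
  rcases lt_or_ge n N with hn | hn
  · exact Or.inl ⟨n, hn, rfl⟩
  · exact Or.inr (hN n hn)

variable [Algebra k R]

variable (k R) in
/-- The matrix over the ring of eventually constant sequences whose terms are the matrices of a
convergent sequence of permutations. -/
def permSeq {π : ℕ → Equiv.Perm ℕ} {τ : Equiv.Perm ℕ} (h : PermTendsto π τ) :
    ColFin (eventuallyConst k R) where
  val i j := ⟨(fun n => (ColFin.perm R (π n)).val i j, (ColFin.perm R τ).val i j), by
    filter_upwards [h j] with n hn
    simp only [ColFin.perm_val, hn]⟩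
  finite_col j := by
    refine ((h.finite_range j).union (Set.finite_singleton (τ j))).subset fun i hi => ?_
    by_contra hc
    simp only [Set.mem_union, Set.mem_range, Set.mem_singleton_iff, not_or, not_exists] at hc
    refine hi (Subtype.ext (Prod.ext ?_ ?_))
    · funext n
      exact if_neg fun e => hc.1 n e.symm
    · exact if_neg hc.2

variable (k R) in
/-- The `n`-th term of a sequence. -/
def evalSeq (n : ℕ) : eventuallyConst k R →ₐ[k] R :=
  ((Pi.evalAlgHom k (fun _ : ℕ => R) n).comp (AlgHom.fst k (ℕ → R) R)).comp
    (eventuallyConst k R).val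

variable (k R) in
/-- The limit of a sequence. -/
def limSeq : eventuallyConst k R →ₐ[k] R :=
  (AlgHom.snd k (ℕ → R) R).comp (eventuallyConst k R).val

variable (k R) in
/-- The constant sequence. -/
def constSeq : R →+* eventuallyConst k R where
  toFun r := ⟨(fun _ => r, r), Filter.Eventually.of_forall fun _ => rfl⟩
  map_one' := rfl
  map_zero' := rfl
  map_mul' _ _ := rfl
  map_add' _ _ := rfl

theorem map_evalSeq_permSeq {π : ℕ → Equiv.Perm ℕ} {τ : Equiv.Perm ℕ} (h : PermTendsto π τ)
    (n : ℕ) : ColFin.map (evalSeq k R n : eventuallyConst k R →+* R) (permSeq k R h) =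
      ColFin.perm R (π n) := rfl

theorem map_limSeq_permSeq {π : ℕ → Equiv.Perm ℕ} {τ : Equiv.Perm ℕ} (h : PermTendsto π τ) :
    ColFin.map (limSeq k R : eventuallyConst k R →+* R) (permSeq k R h) = ColFin.perm R τ := rfl

theorem colFin_seq_ext {x y : ColFin (eventuallyConst k R)}
    (h1 : ∀ n, ColFin.map (evalSeq k R n : eventuallyConst k R →+* R) x =
      ColFin.map (evalSeq k R n : eventuallyConst k R →+* R) y)
    (h2 : ColFin.map (limSeq k R : eventuallyConst k R →+* R) x =
      ColFin.map (limSeq k R : eventuallyConst k R →+* R) y) : x = y := by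
  refine ColFin.ext (Matrix.ext fun i j => Subtype.ext (Prod.ext ?_ ?_))
  · funext n
    exact congrArg (fun z : ColFin R => z.val i j) (h1 n)
  · exact congrArg (fun z : ColFin R => z.val i j) h2

theorem permSeq_mul_permSeq {π ρ : ℕ → Equiv.Perm ℕ} {τ υ : Equiv.Perm ℕ}
    (h : PermTendsto π τ) (h' : PermTendsto ρ υ) (hn : ∀ n, π n * ρ n = 1) (hl : τ * υ = 1) :
    permSeq k R h * permSeq k R h' = 1 := by
  refine colFin_seq_ext (fun n => ?_) ?_
  · rw [map_mul, map_evalSeq_permSeq, map_evalSeq_permSeq, ColFin.perm_mul, hn, map_one,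
      ColFin.perm_one]
  · rw [map_mul, map_limSeq_permSeq, map_limSeq_permSeq, ColFin.perm_mul, hl, map_one,
      ColFin.perm_one]

variable (k R) in
/-- `permSeq` as an invertible matrix. -/
def permSeqGL {π : ℕ → Equiv.Perm ℕ} {τ : Equiv.Perm ℕ} (h : PermTendsto π τ) :
    GLInf (eventuallyConst k R) where
  val := permSeq k R h
  inv := permSeq k R h.inv
  val_inv := permSeq_mul_permSeq _ _ (fun _ => mul_inv_cancel _) (mul_inv_cancel _)
  inv_val := permSeq_mul_permSeq _ _ (fun _ => inv_mul_cancel _) (inv_mul_cancel _)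

/-- A closed subfunctor that contains the double cosets of a convergent sequence of permutations
contains the double coset of the limit. -/
theorem doubleCoset_le_of_tendsto {Z : Subfunctor (glFunctor k)} (hZ : IsClosedSubfunctor Z)
    {π : ℕ → Equiv.Perm ℕ} {τ : Equiv.Perm ℕ} (h : PermTendsto π τ)
    (hπ : ∀ n, doubleCoset k (π n) ≤ Z) : doubleCoset k τ ≤ Z := by
  rintro R g ⟨b, c, hb, hc, rfl⟩
  let S : CommAlgCat.{u} k := CommAlgCat.of k (eventuallyConst k R)
  let ev (n : ℕ) : S ⟶ R := CommAlgCat.ofHom (evalSeq k R n)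
  let lim : S ⟶ R := CommAlgCat.ofHom (limSeq k R)
  let x : GLInf S := glMap (constSeq k R) b * permSeqGL k R h * glMap (constSeq k R) c
  obtain ⟨I, hI⟩ := hZ.exists_ideal S x
  have hev (n : ℕ) : (glFunctor k).map (ev n) x = b * permGL R (π n) * c := by
    change glMap (evalSeq k R n : eventuallyConst k R →+* R) _ = _
    rw [map_mul, map_mul, glMap_glMap_of_comp_eq_id fun _ => rfl,
      glMap_glMap_of_comp_eq_id fun _ => rfl]
    rfl
  have hlim : (glFunctor k).map lim x = b * permGL R τ * c := by
    change glMap (limSeq k R : eventuallyConst k R →+* R) _ = _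
    rw [map_mul, map_mul, glMap_glMap_of_comp_eq_id fun _ => rfl,
      glMap_glMap_of_comp_eq_id fun _ => rfl]
    rfl
  rw [← hlim, hI]
  intro a ha
  have ha0 (n : ℕ) : (ev n).hom a = 0 := by
    refine (hI R (ev n)).mp ?_ a ha
    rw [hev]
    exact hπ n R ⟨b, c, hb, hc, rfl⟩
  -- The limit of `a` is one of its terms, and all terms are zero.
  obtain ⟨n, hn⟩ := (show ∀ᶠ n in Filter.atTop, a.1.1 n = a.1.2 from a.2).exists
  exact hn.symm.trans (ha0 n)

end Closed

end InfSchubert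

namespace InfSchubert

/-! ### Combinatorics of the infinite Bruhat order -/

section Bruhat

theorem card_filter_orderEmbOfFin {n : ℕ} (X : Finset ℕ) (hX : X.card = n) (q : ℕ) :
    (X.filter (· < q)).card = (Finset.univ.filter fun i => X.orderEmbOfFin hX i < q).card := by
  conv_lhs => rw [← X.map_orderEmbOfFin_univ hX]
  rw [Finset.filter_map, Finset.card_map]
  rfl

/-- Counting elements below each threshold replaces sorted lists, so the order becomes a family of
inequalities that can be summed term by term. If the comparison fails at position `p`, the threshold
just above the `p`-th element of `Y` detects it. -/
theorem subsetLE_iff {n : ℕ} {X Y : Finset ℕ} (hX : X.card = n) (hY : Y.card = n) :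
    SubsetLE X Y hX hY ↔ ∀ q, (Y.filter (· < q)).card ≤ (X.filter (· < q)).card := by
  simp only [card_filter_orderEmbOfFin X hX, card_filter_orderEmbOfFin Y hY]
  refine ⟨fun h q => Finset.card_le_card ?_, fun h p => ?_⟩
  · exact Finset.monotone_filter_right _ fun i _ hi => (h i).trans_lt hi
  · by_contra! hlt
    have h1 : (Finset.Iic p).card ≤
        (Finset.univ.filter fun i => Y.orderEmbOfFin hY i < Y.orderEmbOfFin hY p + 1).card := by
      refine Finset.card_le_card fun i hi => ?_
      simpa [Nat.lt_succ_iff] using hi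
    have h2 : (Finset.univ.filter fun i =>
        X.orderEmbOfFin hX i < Y.orderEmbOfFin hY p + 1).card ≤ (Finset.Iio p).card := by
      refine Finset.card_le_card fun i hi => ?_
      have : X.orderEmbOfFin hX i < X.orderEmbOfFin hX p := by
        simp only [Finset.mem_filter] at hi
        omega
      simpa using this
    have h3 := h (Y.orderEmbOfFin hY p + 1)
    simp only [Fin.card_Iic, Fin.card_Iio] at h1 h2
    omega

/-- The number of values less than `q` among the first `n` values of `τ`. -/
def countLT (τ : Equiv.Perm ℕ) (n q : ℕ) : ℕ := ∑ c ∈ Finset.range n, if τ c < q then 1 else 0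

theorem card_firstValues_filter (τ : Equiv.Perm ℕ) (n q : ℕ) :
    ((firstValues τ n).filter (· < q)).card = countLT τ n q := by
  rw [firstValues, Finset.filter_map, Finset.card_map, Finset.card_filter]
  rfl

theorem bruhatLE_iff {τ σ : Equiv.Perm ℕ} :
    BruhatLE τ σ ↔ ∀ n q, countLT σ n q ≤ countLT τ n q := by
  simp only [BruhatLE, subsetLE_iff, card_firstValues_filter]

theorem countLT_congr {τ σ : Equiv.Perm ℕ} {n : ℕ} (h : ∀ c < n, τ c = σ c) (q : ℕ) :
    countLT τ n q = countLT σ n q :=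
  Finset.sum_congr rfl fun c hc => by rw [h c (by simpa using hc)]

theorem BruhatLE.apply_le {τ σ : Equiv.Perm ℕ} (h : BruhatLE τ σ) {a : ℕ}
    (ha : ∀ c < a, τ c = σ c) : τ a ≤ σ a := by
  have h1 := bruhatLE_iff.mp h (a + 1) (σ a + 1)
  rw [countLT, countLT, Finset.sum_range_succ, Finset.sum_range_succ, ← countLT, ← countLT,
    countLT_congr ha] at h1
  by_contra! hlt
  rw [if_pos (by omega), if_neg (by omega)] at h1
  omega

/-- The effect on the counts of exchanging two values. -/
theorem countLT_mul_swap (σ : Equiv.Perm ℕ) {a b : ℕ} (hab : a < b) (n q : ℕ) :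
    countLT (σ * Equiv.swap a b) n q + (if a < n ∧ n ≤ b ∧ σ a < q then 1 else 0) =
      countLT σ n q + (if a < n ∧ n ≤ b ∧ σ b < q then 1 else 0) := by
  induction n with
  | zero => simp [countLT]
  | succ n ih =>
    rw [countLT, countLT, Finset.sum_range_succ, Finset.sum_range_succ, ← countLT, ← countLT,
      Equiv.Perm.mul_apply]
    rcases eq_or_ne n a with rfl | hna
    · rw [Equiv.swap_apply_left]
      split_ifs at * <;> omega
    · rcases eq_or_ne n b with rfl | hnb
      · rw [Equiv.swap_apply_right]
        split_ifs at * <;> omega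
      · rw [Equiv.swap_apply_of_ne_of_ne hna hnb]
        split_ifs at * <;> omega

/-- Lowering the larger of two permutations at the first place where they differ. -/
theorem BruhatLE.exists_swap {τ σ : Equiv.Perm ℕ} (h : BruhatLE τ σ) {a : ℕ}
    (ha : ∀ c < a, τ c = σ c) (hne : τ a ≠ σ a) :
    ∃ b, a < b ∧ σ b < σ a ∧ BruhatLE τ (σ * Equiv.swap a b) := by
  have hlt : τ a < σ a := (h.apply_le ha).lt_of_ne hne
  have hex : ∃ b, a < b ∧ τ a ≤ σ b ∧ σ b < σ a := by
    -- The value `τ a` cannot occur in `σ` before `a`, where `σ` agrees with `τ`, nor at `a`. The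
    -- least admissible `b` is used below.
    refine ⟨σ⁻¹ (τ a), ?_, ?_⟩
    · by_contra! hle
      have e : σ (σ⁻¹ (τ a)) = τ a := σ.apply_symm_apply _
      rcases hle.lt_or_eq with hc | hc
      · exact hc.ne (τ.injective ((ha _ hc).trans e))
      · rw [hc] at e
        exact hne e.symm
    · have e : σ (σ⁻¹ (τ a)) = τ a := σ.apply_symm_apply _
      rw [e]
      exact ⟨le_rfl, hlt⟩
  classical
  obtain ⟨hab, hτb, hba⟩ := Nat.find_spec hex
  have hmin : ∀ c, c < Nat.find hex → ¬ (a < c ∧ τ a ≤ σ c ∧ σ c < σ a) :=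
    fun c hc => Nat.find_min hex hc
  generalize Nat.find hex = b at *
  refine ⟨b, hab, hba, bruhatLE_iff.mpr fun n q => ?_⟩
  have hsw := countLT_mul_swap σ hab n q
  have hnq := bruhatLE_iff.mp h n q
  -- Only in this range does the exchange raise the count of `σ`, and by one, so a strict inequality
  -- for `(n, q)` is needed. It holds because, by minimality of `b`, no `σ c` with `a < c < n` lies
  -- in `[τ a, σ a)`, while position `a` counts for `τ` but not for `σ`.
  by_cases hc : a < n ∧ n ≤ b ∧ σ b < q ∧ q ≤ σ a
  · obtain ⟨han, hnb, hbq, hqa⟩ := hc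
    rw [if_neg (by omega), if_pos (by omega)] at hsw
    have h1 := bruhatLE_iff.mp h n (τ a)
    -- compare, term by term, the differences between the counts for `q` and for `τ a`
    have h2 : countLT σ n q + countLT τ n (τ a) + 1 ≤ countLT τ n q + countLT σ n (τ a) := by
      have e : ∀ c ∈ Finset.range n, ((if σ c < q then 1 else 0) + (if τ c < τ a then 1 else 0) +
          if c = a then 1 else 0) ≤
            (if τ c < q then 1 else 0) + if σ c < τ a then 1 else 0 := by
        intro c hc
        have hcn : c < n := by simpa using hc
        rcases lt_trichotomy c a with hca | rfl | hca
        · rw [ha c hca, if_neg hca.ne]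
          omega
        · rw [if_neg (by omega), if_neg (by omega), if_pos rfl, if_pos (by omega)]
          omega
        · have h3 := hmin c (by omega)
          rw [if_neg hca.ne']
          split_ifs <;> omega
      have := Finset.sum_le_sum e
      simp only [Finset.sum_add_distrib, Finset.sum_ite_eq', Finset.mem_range, if_pos han] at this
      exact this
    omega
  · split_ifs at hsw <;> omega

/-- A closed subfunctor that contains the double coset of `σ` contains that of every `τ ≤ σ`. -/
theorem BruhatLE.doubleCoset_le {k : Type u} [CommRing k] {Z : Subfunctor (glFunctor k)}
    (hZ : IsClosedSubfunctor Z) {τ σ : Equiv.Perm ℕ} (h : BruhatLE τ σ)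
    (hσ : doubleCoset k σ ≤ Z) : doubleCoset k τ ≤ Z := by
  -- Strong induction on the value `v` at `a`: each exchange strictly lowers it and leaves the
  -- earlier places alone.
  have step : ∀ (a v : ℕ) (ρ : Equiv.Perm ℕ), ρ a = v → (∀ c < a, τ c = ρ c) → BruhatLE τ ρ →
      doubleCoset k ρ ≤ Z → ∃ ρ' : Equiv.Perm ℕ, (∀ c < a + 1, τ c = ρ' c) ∧ BruhatLE τ ρ' ∧
        doubleCoset k ρ' ≤ Z := by
    intro a v
    induction v using Nat.strong_induction_on with
    | _ v ih =>
      rintro ρ rfl hρ hle hρZ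
      by_cases hne : τ a = ρ a
      · exact ⟨ρ, fun c hc => (Nat.lt_succ_iff_lt_or_eq.mp hc).elim (hρ c) (by rintro rfl; exact hne),
          hle, hρZ⟩
      · obtain ⟨b, hab, hba, hle'⟩ := hle.exists_swap hρ hne
        refine ih (ρ b) hba (ρ * Equiv.swap a b) ?_ (fun c hc => ?_) hle' ?_
        · rw [Equiv.Perm.mul_apply, Equiv.swap_apply_left]
        · rw [Equiv.Perm.mul_apply, Equiv.swap_apply_of_ne_of_ne (by omega) (by omega), hρ c hc]
        · refine doubleCoset_le_of_swap hZ hab ?_ ?_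
          · simpa using hba
          · rwa [mul_assoc, Equiv.swap_mul_self, mul_one]
  have all : ∀ m : ℕ, ∃ ρ : Equiv.Perm ℕ, (∀ c < m, τ c = ρ c) ∧ BruhatLE τ ρ ∧
      doubleCoset k ρ ≤ Z := by
    intro m
    induction m with
    | zero => exact ⟨σ, by simp, h, hσ⟩
    | succ m ih =>
      obtain ⟨ρ, h1, h2, h3⟩ := ih
      exact step m _ ρ rfl h1 h2 h3
  choose π hπ _ hπZ using all
  refine doubleCoset_le_of_tendsto hZ (π := π) (fun j => ?_) hπZ
  filter_upwards [Filter.eventually_gt_atTop j] with n hn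
  exact (hπ n j hn).symm

end Bruhat

end InfSchubert

namespace InfSchubert

/-! ### The determinantal equations of a double coset -/

section Minors

variable {R : Type u} [CommRing R]

/-- The minor of `x` on the rows in `X` and the first `n` columns. -/
noncomputable def minor (x : ColFin R) {n : ℕ} (X : Finset ℕ) (hX : X.card = n) : R :=
  (Matrix.of fun p q : Fin n => x.val (X.orderEmbOfFin hX p) q).det

theorem minor_map {S : Type u} [CommRing S] (φ : R →+* S) (x : ColFin R) {n : ℕ} (X : Finset ℕ)
    (hX : X.card = n) : minor (ColFin.map φ x) X hX = φ (minor x X hX) := by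
  rw [minor, minor, RingHom.map_det]
  rfl

theorem IsUpper.det {x : ColFin R} (hx : IsUpper x) {n : ℕ} (f : Fin n ↪o ℕ) :
    (Matrix.of fun p q : Fin n => x.val (f p) (f q)).det = ∏ p, x.val (f p) (f p) :=
  Matrix.det_of_isUpperTriangular fun _ _ hij => hx _ _ (f.lt_iff_lt.mpr hij)

/-- The first `n` columns of `x * y` only involve the first `n` columns of `x`, so the submatrix is
a product of finite matrices. -/
theorem minor_mul (x : ColFin R) {y : ColFin R} (hy : IsUpper y) {n : ℕ} (X : Finset ℕ)
    (hX : X.card = n) :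
    minor (x * y) X hX = minor x X hX * ∏ p : Fin n, y.val p p := by
  have h := hy.det (Fin.valOrderEmb n)
  simp only [Fin.valOrderEmb_apply] at h
  rw [← h, minor, minor, ← Matrix.det_mul]
  congr 1
  ext p q
  rw [Matrix.mul_apply]
  simp only [Matrix.of_apply]
  rw [ColFin.mul_val_eq_sum _ _ _ _ (Finset.range n), Finset.sum_range]
  intro m hm
  by_contra hmn
  exact hm (hy m q (by simp at hmn; omega))

/-- The minor on rows that are not below the first values of `σ` vanishes on `B σ B`. -/
theorem minor_eq_zero {b c : ColFin R} (hb : IsUpper b) (hc : IsUpper c) (σ : Equiv.Perm ℕ)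
    {n : ℕ} (X : Finset ℕ) (hX : X.card = n)
    (h : ¬ SubsetLE X (firstValues σ n) hX (card_firstValues σ n)) :
    minor (b * ColFin.perm R σ * c) X hX = 0 := by
  rw [minor_mul _ hc, minor, Matrix.det_apply, Finset.sum_eq_zero, zero_mul]
  intro π _
  suffices ∃ p : Fin n, σ p < X.orderEmbOfFin hX (π p) by
    obtain ⟨p, hp⟩ := this
    rw [Finset.prod_eq_zero (Finset.mem_univ p), smul_zero]
    rw [Matrix.of_apply, ColFin.mul_perm_val, hb _ _ hp]
  -- Otherwise `π` injects the positions with `σ p < q` into those with an element of `X` below `q`,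
  -- for every `q`, and `X` would be below the first values of `σ`.
  by_contra! hle
  refine h ((subsetLE_iff _ _).mpr fun q => ?_)
  rw [card_filter_orderEmbOfFin X hX, card_firstValues_filter, countLT, Finset.sum_range,
    ← Finset.card_filter]
  refine Finset.card_le_card_of_injOn π (fun p hp => ?_) π.injective.injOn
  simp only [Finset.coe_filter, Finset.mem_univ, true_and, Set.mem_ofPred_eq] at hp ⊢
  exact (hle p).trans_lt hp

/-- Up to a column permutation and a product of diagonal units of `c`, this is a principal minor of
`b`, itself a product of diagonal units. -/
theorem minor_firstValues_ne_zero [Nontrivial R] {b c : GLInf R} (hb : IsUpper b.val)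
    (hc : IsUpper c.val) (τ : Equiv.Perm ℕ) (n : ℕ) :
    minor (b * permGL R τ * c).val (firstValues τ n) (card_firstValues τ n) ≠ 0 := by
  have hmem : ∀ p : Fin n, τ p ∈ firstValues τ n := fun p =>
    Finset.mem_map_of_mem _ (by simp)
  set X := firstValues τ n with hXdef
  have hX := card_firstValues τ n
  let e : Fin n → Fin n := fun p => (X.orderIsoOfFin hX).symm ⟨τ p, hmem p⟩
  have he : ∀ p, X.orderEmbOfFin hX (e p) = τ p := fun p => by
    rw [← Finset.coe_orderIsoOfFin_apply, OrderIso.apply_symm_apply]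
  have hinj : Function.Injective e := fun p q hpq => by
    have := he p
    rw [hpq, he q] at this
    exact Fin.ext (τ.injective this).symm
  let ε : Equiv.Perm (Fin n) := Equiv.ofBijective e (Finite.injective_iff_bijective.mp hinj)
  have hunit : IsUnit (minor (b * permGL R τ * c).val X hX) := by
    rw [Units.val_mul, minor_mul _ hc]
    refine IsUnit.mul ?_ (IsUnit.prod_univ_iff.mpr fun p => hc.isUnit_diag p)
    have : minor (b * permGL R τ).val X hX = (Equiv.Perm.sign ε : ℤ) *
        (Matrix.of fun p q : Fin n => b.val.val (X.orderEmbOfFin hX p)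
          (X.orderEmbOfFin hX q)).det := by
      rw [← Matrix.det_permute', minor]
      congr 1
      ext p q
      change (b.val * ColFin.perm R τ).val _ _ = b.val.val _ (X.orderEmbOfFin hX (e q))
      rw [he, ColFin.mul_perm_val]
      rfl
    rw [this, hb.det]
    exact IsUnit.mul ((ε.sign.isUnit).map (Int.castRingHom R))
      (IsUnit.prod_univ_iff.mpr fun p => hb.isUnit_diag _)
  exact hunit.ne_zero

variable (k : Type u) [CommRing k]

/-- The subfunctor of matrices whose minors on the first `n` columns and on rows that are not below
the first values of `σ` vanish. -/
def minorSubfunctor (σ : Equiv.Perm ℕ) : Subfunctor (glFunctor k) where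
  obj R := {g : GLInf R | ∀ (n : ℕ) (X : Finset ℕ) (hX : X.card = n),
    ¬ SubsetLE X (firstValues σ n) hX (card_firstValues σ n) → minor g.val X hX = 0}
  map {R S} φ := by
    intro g hg n X hX h
    change minor (ColFin.map (φ.hom : R →+* S) (show GLInf R from g).val) X hX = 0
    rw [minor_map, hg n X hX h, map_zero]

theorem isClosed_minorSubfunctor (σ : Equiv.Perm ℕ) :
    IsClosedSubfunctor (minorSubfunctor k σ) := by
  intro R f
  let g : GLInf R := coyonedaEquiv f
  -- The ideal is generated by the minors of the matrix `g` that corresponds to `f`.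
  refine ⟨Ideal.span {a | ∃ (n : ℕ) (X : Finset ℕ) (hX : X.card = n),
    ¬ SubsetLE X (firstValues σ n) hX (card_firstValues σ n) ∧ a = minor g.val X hX}, ?_⟩
  ext A φ
  change f.app A φ ∈ (minorSubfunctor k σ).obj A ↔ ∀ a ∈ _, φ.hom a = 0
  rw [← map_coyonedaEquiv]
  have hm : ∀ (n : ℕ) (X : Finset ℕ) (hX : X.card = n),
      minor ((glFunctor k).map φ g : GLInf A).val X hX = φ.hom (minor g.val X hX) :=
    fun n X hX => minor_map (φ.hom : R →+* A) _ X hX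
  constructor
  · intro h
    change Ideal.span _ ≤ RingHom.ker (φ.hom : R →+* A)
    rw [Ideal.span_le]
    rintro _ ⟨n, X, hX, hn, rfl⟩
    exact (hm n X hX).symm.trans (h n X hX hn)
  · intro h n X hX hn
    exact (hm n X hX).trans (h _ (Ideal.subset_span ⟨n, X, hX, hn, rfl⟩))

theorem doubleCoset_le_minorSubfunctor (σ : Equiv.Perm ℕ) :
    doubleCoset k σ ≤ minorSubfunctor k σ := by
  rintro R g ⟨b, c, hb, hc, rfl⟩ n X hX h
  exact minor_eq_zero hb hc σ X hX h

end Minors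

/-! ### The Bruhat decomposition over a field -/

section Decomposition

variable {K : Type u} [CommRing K]

/-- Some vector `∑ₙ aₙ gₙ` with `aⱼ = 1` and `aₙ = 0` for `n > j`, where `gₙ` are the columns
of `g`, vanishes in all rows from `d` on. -/
def HasReducedColumn (g : GLInf K) (j d : ℕ) (a : ℕ → K) : Prop :=
  (∀ n, j < n → a n = 0) ∧ a j = 1 ∧
    ∀ i, d ≤ i → ∑ n ∈ Finset.range (j + 1), g.val.val i n * a n = 0

theorem exists_hasReducedColumn (g : GLInf K) (j : ℕ) : ∃ d a, HasReducedColumn g j d a := by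
  obtain ⟨N, hN⟩ := (g.val.finite_col j).bddAbove
  refine ⟨N + 1, Pi.single j 1, fun n hn => Pi.single_eq_of_ne hn.ne' _,
    Pi.single_eq_same _ _, fun i hi => ?_⟩
  rw [Finset.sum_eq_single j]
  · by_contra h
    have := hN (show i ∈ {i | g.val.val i j ≠ 0} by simpa using h)
    omega
  · intro n _ hn
    rw [Pi.single_eq_of_ne hn, mul_zero]
  · simp

theorem exists_col_ne_zero [Nontrivial K] (g : GLInf K) (j : ℕ) : ∃ i, g.val.val i j ≠ 0 := by
  by_contra! h
  have h1 : (g⁻¹.val * g.val).val j j = 0 := by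
    rw [ColFin.mul_val_eq_sum _ _ _ _ ∅ (fun n hn => absurd (h n) hn), Finset.sum_empty]
  rw [← Units.val_mul, inv_mul_cancel, Units.val_one, ColFin.one_val, Matrix.one_apply_eq] at h1
  exact one_ne_zero h1

/-- Every column-finite invertible matrix over a field lies in some double coset. -/
theorem exists_bruhat_decomposition (hK : IsField K) (g : GLInf K) :
    ∃ (τ : Equiv.Perm ℕ) (b c : GLInf K), IsUpper b.val ∧ IsUpper c.val ∧
      g = b * permGL K τ * c := by
  classical
  have := hK.nontrivial
  have := hK.isDomain
  -- Each column is reduced by earlier ones until its support ends as early as possible. The pivot,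
  -- its last nonzero entry, is then in row `d j - 1`, and this row will be `τ j`.
  obtain ⟨d, hd⟩ : ∃ d : ℕ → ℕ, ∀ j, (∃ a, HasReducedColumn g j (d j) a) ∧
      ∀ {m}, m < d j → ¬ ∃ a, HasReducedColumn g j m a :=
    ⟨fun j => Nat.find (exists_hasReducedColumn g j), fun j =>
      ⟨Nat.find_spec (exists_hasReducedColumn g j), Nat.find_min (exists_hasReducedColumn g j)⟩⟩
  choose a ha using fun j => (hd j).1
  replace hd := fun j m => (hd j).2 (m := m)
  let C : ColFin K := ⟨Matrix.of fun i j => a j i, fun j =>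
    (Set.finite_le_nat j).subset fun i hi => by
      by_contra h
      exact hi ((ha j).1 i (by simpa using h))⟩
  have hC : IsUnitriangular C := ⟨fun i j hij => (ha j).1 i hij, fun j => (ha j).2.1⟩
  obtain ⟨c, hc⟩ := hC.isUnit
  have hcU : IsUpper c.val := hc ▸ hC.1
  let M : GLInf K := g * c
  have hM : ∀ i j, M.val.val i j = ∑ n ∈ Finset.range (j + 1), g.val.val i n * a j n :=
    fun i j => by
      change (g.val * c.val).val i j = _
      rw [hc, hC.1.mul_val]
      rfl
  have hM0 : ∀ i j, d j ≤ i → M.val.val i j = 0 := fun i j hi => by rw [hM, (ha j).2.2 i hi]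
  have hdpos : ∀ j, 0 < d j := fun j => by
    obtain ⟨i, hi⟩ := exists_col_ne_zero M j
    by_contra h
    exact hi (hM0 i j (by omega))
  have hpiv : ∀ j, M.val.val (d j - 1) j ≠ 0 := fun j h => by
    refine hd j (d j - 1) (Nat.sub_lt (hdpos j) one_pos) ⟨a j, (ha j).1, (ha j).2.1,
      fun i hi => ?_⟩
    rcases hi.eq_or_lt with rfl | hlt
    · rw [← hM, h]
    · exact (ha j).2.2 i (by omega)
  -- If two pivots shared a row, subtracting a multiple of column `i` would clear the pivot of
  -- column `j`, against the minimality of `d j`.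
  have hinj' : ∀ i j, i < j → d i ≠ d j := fun i j hij hij' => by
    obtain ⟨r, hr⟩ := hK.mul_inv_cancel (hpiv i)
    let s := M.val.val (d i - 1) j * r
    refine hd j (d j - 1) (Nat.sub_lt (hdpos j) one_pos)
      ⟨fun n => a j n - a i n * s, fun n hn => ?_, ?_, fun l hl => ?_⟩
    · simp only [(ha j).1 n hn, (ha i).1 n (hij.trans hn), zero_mul, sub_zero]
    · simp only [(ha j).2.1, (ha i).1 j hij, zero_mul, sub_zero]
    · have e1 : ∑ n ∈ Finset.range (j + 1), g.val.val l n * a i n = M.val.val l i := by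
        rw [hM]
        refine (Finset.sum_subset (Finset.range_mono (by omega)) fun n _ hn => ?_).symm
        rw [(ha i).1 n (by simpa using hn), mul_zero]
      have e2 : ∑ n ∈ Finset.range (j + 1), g.val.val l n * (a j n - a i n * s) =
          M.val.val l j - M.val.val l i * s := by
        rw [← e1, hM, Finset.sum_mul, ← Finset.sum_sub_distrib]
        exact Finset.sum_congr rfl fun n _ => by ring
      rw [e2]
      rcases hl.eq_or_lt with rfl | hlt
      · rw [← hij']
        linear_combination (-M.val.val (d i - 1) j) * hr
      · rw [hM0 l j (by omega), hM0 l i (by omega), zero_mul, sub_zero]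
  have hinj : Function.Injective fun j => d j - 1 := fun i j hij => by
    have hij' : d i = d j := by
      have := hdpos i
      have := hdpos j
      simp only at hij
      omega
    rcases lt_trichotomy i j with h | h | h
    · exact absurd hij' (hinj' i j h)
    · exact h
    · exact absurd hij'.symm (hinj' j i h)
  -- Column `m` of `M⁻¹` writes `e_m` as a finite combination of columns of `M`. Pivots being
  -- distinct, the largest one involved cannot cancel, so it lies in row `m`.
  have hsurj : Function.Surjective fun j => d j - 1 := fun m => by
    let w : ℕ → K := fun n => M⁻¹.val.val n m
    let s : Finset ℕ := (M⁻¹.val.finite_col m).toFinset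
    have hs : ∀ n, n ∈ s ↔ w n ≠ 0 := fun n => by simp [s, w]
    have hMw : ∀ i, ∑ n ∈ s, M.val.val i n * w n = (1 : Matrix ℕ ℕ K) i m := fun i => by
      rw [← ColFin.one_val, ← M.mul_inv,
        ColFin.mul_val_eq_sum _ _ _ _ s fun n hn => (hs n).mpr hn]
    have hne : s.Nonempty := by
      obtain ⟨n, hn⟩ := exists_col_ne_zero M⁻¹ m
      exact ⟨n, (hs n).mpr hn⟩
    obtain ⟨j, hj, hmax⟩ := s.exists_max_image d hne
    refine ⟨j, ?_⟩
    by_contra hjm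
    have h := hMw (d j - 1)
    rw [Matrix.one_apply_ne hjm, Finset.sum_eq_single_of_mem j hj] at h
    · exact mul_ne_zero (hpiv j) ((hs j).mp hj) h
    · intro n hn hnj
      have h1 := hmax n hn
      have h2 : d n - 1 ≠ d j - 1 := fun e => hnj (hinj e)
      rw [hM0 _ _ (by omega), zero_mul]
  let τ : Equiv.Perm ℕ := Equiv.ofBijective _ ⟨hinj, hsurj⟩
  have hτ : ∀ j, τ j = d j - 1 := fun _ => rfl
  refine ⟨τ, M * (permGL K τ)⁻¹, c⁻¹, fun i l hil => ?_, hcU.inv, ?_⟩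
  · obtain ⟨j, rfl⟩ := τ.surjective l
    change (M.val * ColFin.perm K τ⁻¹).val i (τ j) = 0
    rw [ColFin.mul_perm_val, ← Equiv.Perm.mul_apply, inv_mul_cancel, Equiv.Perm.one_apply]
    rw [hτ] at hil
    exact hM0 i j (by omega)
  · rw [inv_mul_cancel_right, mul_inv_cancel_right]

end Decomposition

end InfSchubert

theorem mainTheorem4 (k : Type u) [CommRing k] [IsDomain k] (σ : Equiv.Perm ℕ) :
    -- each `B τ B` with `τ ≤ σ` is a subfunctor of the closure of `B σ B`
    (∀ τ : Equiv.Perm ℕ, InfSchubert.BruhatLE τ σ →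
      InfSchubert.doubleCoset k τ ≤
        InfSchubert.closureSubfunctor (InfSchubert.doubleCoset k σ)) ∧
    -- these subfunctors are pairwise disjoint on all nonzero `k`-algebras
    (∀ τ τ' : Equiv.Perm ℕ, InfSchubert.BruhatLE τ σ → InfSchubert.BruhatLE τ' σ → τ ≠ τ' →
      ∀ R : CommAlgCat.{u} k, Nontrivial R →
        Disjoint ((InfSchubert.doubleCoset k τ).obj R)
          ((InfSchubert.doubleCoset k τ').obj R)) ∧
    -- they cover the closure on all `k`-algebras that are fields
    (∀ R : CommAlgCat.{u} k, IsField R →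
      (InfSchubert.closureSubfunctor (InfSchubert.doubleCoset k σ)).obj R =
        ⋃ (τ : Equiv.Perm ℕ) (_ : InfSchubert.BruhatLE τ σ),
          (InfSchubert.doubleCoset k τ).obj R) := by
  have h1 : ∀ τ : Equiv.Perm ℕ, InfSchubert.BruhatLE τ σ →
      InfSchubert.doubleCoset k τ ≤
        InfSchubert.closureSubfunctor (InfSchubert.doubleCoset k σ) :=
    fun τ hτ R g hg => InfSchubert.mem_closure_iff.mpr fun Z hZ hσ => hτ.doubleCoset_le hZ hσ R hg
  refine ⟨h1, fun τ τ' _ _ hne R _ => Set.disjoint_left.mpr ?_, fun R hR => ?_⟩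
  · rintro g ⟨b, c, hb, hc, rfl⟩ ⟨b', c', hb', hc', h⟩
    exact hne (InfSchubert.perm_eq_of_mul_eq hb hc hb' hc' h)
  · refine Set.Subset.antisymm (fun g hg => ?_) (Set.iUnion₂_subset fun τ hτ => h1 τ hτ R)
    have := hR.nontrivial
    obtain ⟨τ, b, c, hb, hc, rfl⟩ := InfSchubert.exists_bruhat_decomposition hR g
    -- Points of the closure satisfy the minor equations of `σ`; a failure of `τ ≤ σ` at `n` would
    -- kill a minor that is nonzero on `BτB`.
    have hmem := InfSchubert.mem_closure_iff.mp hg _ (InfSchubert.isClosed_minorSubfunctor k σ)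
      (InfSchubert.doubleCoset_le_minorSubfunctor k σ)
    refine Set.mem_iUnion₂.mpr ⟨τ, fun n => ?_, b, c, hb, hc, rfl⟩
    by_contra hn
    exact InfSchubert.minor_firstValues_ne_zero hb hc τ n
      (hmem n _ (InfSchubert.card_firstValues τ n) hn)
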